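/- For $0<\sigma\le\pi$ and $s\in\mathbb{C}$ with $\Re(s)>1$, let $$\mathrm{SLs}(s;\sigma)=\frac{1}{\Gamma(s-1)}\int_0^\sigma(\theta-\sigma)\left(-2\log\frac{\sin(\theta/2)}{\sin(\sigma/2)}\right)^{s-2}\mathrm{d}\theta .$$ Define polynomials $p_n,q_n\in\mathbb{Z}[x]$ for integers $n\ge-1$ by $p_{-1}=0$, $q_{-1}=1$ and $$p_{n+1}(x)=2(nx+1)p_n(x)+2x(1-x)p_n'(x)+q_n(x),$$ $$q_{n+1}(x)=(2(n+1)x+1)q_n(x)+2x(1-x)q_n'(x).$$ For $k\in\mathbb{Z}$, define the poly-Bernoulli numbers $B_n^{(k)}\in\mathbb{Q}$ ($n\ge0$) by $$\sum_{n=0}^\infty B_n^{(k)}\frac{x^n}{n!}=\frac{\mathrm{Li}_k(1-e^{-x})}{1-e^{-x}},\qquad \mathrm{Li}_k(z)=\sum_{m=1}^\infty\frac{z^m}{m^k}.$$ Theorem. Let $0<\sigma<\pi$. The integral defining $\mathrm{SLs}(s;\sigma)$ converges absolutely for $\Re(s)>1$, and $\mathrm{SLs}(\,\cdot\,;\sigma)$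 has a unique analytic continuation from the half-plane $\Re(s)>1$ to an entire function on $\mathbb{C}$, again denoted by $\mathrm{SLs}(s;\sigma)$. For every integer $n\ge-1$, $$\mathrm{SLs}(-n;\sigma)=\frac{x\,p_n(x)}{2^n(1-x)^{n+1}},\qquad x=\sin^2(\sigma/2).$$ In particular, for every integer $n\ge0$, $$\mathrm{SLs}(-n;\pi/3)=\frac13\sum_{k=0}^n B_{n-k}^{(-k)}.$$ -/

import Mathlib

noncomputable section

/-- The integrand `(θ - σ) (-2 log (sin (θ/2) / sin (σ/2)))^(s-2)` of the shifted log-sine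
integral. For `0 < θ < σ ≤ π` the base of the complex power is a positive real number. -/
def shiftedLogSineIntegrand (s : ℂ) (σ θ : ℝ) : ℂ :=
  ((θ - σ : ℝ) : ℂ) *
    ((-2 * Real.log (Real.sin (θ / 2) / Real.sin (σ / 2)) : ℝ) : ℂ) ^ (s - 2)

/-- The shifted log-sine integral `SLs(s; σ)` in its domain of definition `0 < σ ≤ π`, `Re s > 1`:
`Γ(s-1)⁻¹ ∫_0^σ (θ - σ) (-2 log (sin (θ/2) / sin (σ/2)))^(s-2) dθ`. -/
def shiftedLogSine (s : ℂ) (σ : ℝ) : ℂ :=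
  1 / Complex.Gamma (s - 1) * ∫ θ in (0 : ℝ)..σ, shiftedLogSineIntegrand s σ θ

/-- `F` is an analytic continuation of `SLs(·; σ)` from the half-plane `Re s > 1` to all of `ℂ`. -/
def IsShiftedLogSineContinuation (σ : ℝ) (F : ℂ → ℂ) : Prop :=
  Differentiable ℂ F ∧ ∀ s : ℂ, 1 < s.re → F s = shiftedLogSine s σ

/-- The pairs of Lehmer polynomials `(p_n, q_n)`, `n ≥ -1`, indexed by `m = n + 1`:
`p_{-1} = 0`, `q_{-1} = 1`,
`p_{n+1} = 2 (n x + 1) p_n + 2 x (1 - x) p_n' + q_n`,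
`q_{n+1} = (2 (n + 1) x + 1) q_n + 2 x (1 - x) q_n'`. -/
def lehmerPair : ℕ → Polynomial ℤ × Polynomial ℤ
  | 0 => (0, 1)
  | m + 1 =>
    let p := (lehmerPair m).1
    let q := (lehmerPair m).2
    (2 * (Polynomial.C ((m : ℤ) - 1) * Polynomial.X + 1) * p
        + 2 * Polynomial.X * (1 - Polynomial.X) * Polynomial.derivative p + q,
      (2 * Polynomial.C (m : ℤ) * Polynomial.X + 1) * q
        + 2 * Polynomial.X * (1 - Polynomial.X) * Polynomial.derivative q)

/-- The Lehmer polynomial `p_n` for an integer `n ≥ -1` (for `n < -1` the value is `0` and has no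
meaning). -/
def lehmerP (n : ℤ) : Polynomial ℤ := (lehmerPair (n + 1).toNat).1

/-- The formal power series `Li_k(z) / z = ∑_{m ≥ 1} z^(m-1) / m^k`, for an integer `k`. -/
def polylogDivX (k : ℤ) : PowerSeries ℚ :=
  PowerSeries.mk fun m : ℕ => 1 / ((m : ℚ) + 1) ^ k

/-- The formal power series `1 - e^(-x)`. -/
def oneSubExpNeg : PowerSeries ℚ :=
  1 - PowerSeries.evalNegHom (PowerSeries.exp ℚ)

/-- The poly-Bernoulli number `B_n^{(k)}`, for an integer `k`, defined by
`∑_n B_n^{(k)} x^n / n! = Li_k(1 - e^(-x)) / (1 - e^(-x))`. -/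
def polyBernoulli (k : ℤ) (n : ℕ) : ℚ :=
  (n.factorial : ℚ) * PowerSeries.coeff n ((polylogDivX k).subst oneSubExpNeg)

end

/-!
Substituting `t = -2 log (sin (θ/2) / sin (σ/2))` turns `SLs(s; σ)` into `Γ(s-1)⁻¹` times the Mellin
transform at `s - 1` of `f(t) = (θ - σ) tan (θ/2)`. All derivatives of `f` decay exponentially, so
repeated integration by parts yields the entire continuation and its values
`SLs(1-m; σ) = (-1)^m f^(m)(0)`. Since `dθ/dt = -tan (θ/2)`, the derivatives of `f` are governed by
the recursion of the Lehmer polynomials.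

The function `f` also satisfies the linear differential equation
`2 (1 - r e^(-t)) f' + f + 2 r e^(-t) = 0` with `r = sin (σ/2)^2`. At `σ = π/3` its `n`-th
derivative at `0` says that `a_m = (-1)^m f^(m)(0)` satisfies
`4 a_{n+1} - ∑ᵢ (n choose i) a_{i+1} = 2 a_n + 1`. The antidiagonal sums of poly-Bernoulli numbers
satisfy the same recurrence up to a factor `3`: as
`B_n^{(-k)} = ∑_j (j!)² S(k+1, j+1) S(n+1, j+1)`, their generating function is `∑_j s_j²` with
`s_j = ∑_n j! S(n+1, j+1) X^n`, and `4 - 2X` minus the binomial transform, applied to `s_j²`,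
telescopes in `j`.
-/

section PolyBernoulli

open PowerSeries

/-- The numbers `j! * S(n+1, j+1)`, with `S` the Stirling numbers of the second kind, in terms of
which poly-Bernoulli numbers of negative index are expressed. -/
def factorialStirling (n j : ℕ) : ℕ := j.factorial * Nat.stirlingSecond (n + 1) (j + 1)

theorem factorialStirling_zero_right (n : ℕ) : factorialStirling n 0 = 1 := by
  simp [factorialStirling, Nat.stirlingSecond_one_right]

theorem factorialStirling_succ_succ (n j : ℕ) :
    factorialStirling (n + 1) (j + 1) =
      (j + 2) * factorialStirling n (j + 1) + (j + 1) * factorialStirling n j := by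
  simp only [factorialStirling, Nat.stirlingSecond_succ_succ (n + 1) (j + 1), Nat.factorial_succ]
  ring

theorem factorialStirling_eq_zero_of_lt {n j : ℕ} (h : n < j) : factorialStirling n j = 0 := by
  simp [factorialStirling, Nat.stirlingSecond_eq_zero_of_lt (Nat.add_lt_add_right h 1)]

theorem factorial_mul_coeff_exp_mul_exp_sub_one_pow (n j : ℕ) :
    (n.factorial : ℚ) * coeff n (exp ℚ * (exp ℚ - 1) ^ j) = factorialStirling n j := by
  induction n generalizing j with
  | zero =>
    rcases j with _ | j
    · simp [factorialStirling_zero_right]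
    · simp [factorialStirling_eq_zero_of_lt]
  | succ n ih =>
    have factorial_mul_coeff_succ (f : ℚ⟦X⟧) :
        ((n + 1).factorial : ℚ) * coeff (n + 1) f = n.factorial * coeff n (d⁄dX ℚ f) := by
      rw [coeff_derivative, Nat.factorial_succ]
      push_cast
      ring
    rw [factorial_mul_coeff_succ]
    rcases j with _ | j
    · simpa [derivative_exp, factorialStirling_zero_right] using ih 0
    · have derivative_eq : d⁄dX ℚ (exp ℚ * (exp ℚ - 1) ^ (j + 1)) =
          ((j : ℚ) + 2) • (exp ℚ * (exp ℚ - 1) ^ (j + 1)) +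
            ((j : ℚ) + 1) • (exp ℚ * (exp ℚ - 1) ^ j) := by
        simp only [Derivation.leibniz, Derivation.leibniz_pow, map_sub, Derivation.map_one_eq_zero,
          derivative_exp, smul_eq_mul, nsmul_eq_mul, Nat.add_sub_cancel, smul_eq_C_mul, map_add,
          map_natCast, map_ofNat, map_one]
        push_cast
        ring
      rw [derivative_eq, map_add, coeff_smul, coeff_smul, factorialStirling_succ_succ]
      push_cast
      rw [← ih, ← ih]
      ring

theorem sum_factorialStirling_mul_choose (m : ℕ) {k J : ℕ} (hJ : k < J) :
    ∑ j ∈ Finset.range J, (factorialStirling k j : ℚ) * m.choose j = ((m : ℚ) + 1) ^ k := by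
  have pow_eq_sum : exp ℚ ^ (m + 1) =
      ∑ j ∈ Finset.range (m + 1), m.choose j • (exp ℚ * (exp ℚ - 1) ^ j) := by
    rw [pow_succ']
    nth_rw 2 [← sub_add_cancel (exp ℚ) 1]
    simp only [add_pow, one_pow, mul_one, Finset.mul_sum, nsmul_eq_mul]
    exact Finset.sum_congr rfl fun j _ => by ring
  have coeff_eq := congrArg (fun f => (k.factorial : ℚ) * coeff k f) pow_eq_sum
  simp only [exp_pow_eq_rescale_exp, coeff_rescale, coeff_exp, map_sum, map_nsmul, Finset.mul_sum,
    mul_smul_comm, factorial_mul_coeff_exp_mul_exp_sub_one_pow] at coeff_eq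
  have factorial_ne : (k.factorial : ℚ) ≠ 0 := by positivity
  calc ∑ j ∈ Finset.range J, (factorialStirling k j : ℚ) * m.choose j
      = ∑ j ∈ Finset.range (m + 1), (m.choose j : ℚ) * factorialStirling k j := by
        refine Finset.sum_congr_of_eq_on_inter (fun j _ hj => ?_) (fun j _ hj => ?_)
          fun j _ _ => mul_comm _ _
        · rw [Nat.choose_eq_zero_of_lt (by simpa using hj), Nat.cast_zero, mul_zero]
        · rw [factorialStirling_eq_zero_of_lt (hJ.trans_le (by simpa using hj)), Nat.cast_zero,
            mul_zero]
    _ = ((m : ℚ) + 1) ^ k := by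
        simp only [← nsmul_eq_mul, ← coeff_eq, Nat.cast_succ]
        simp [field]

theorem coeff_X_pow_mul_mk_one_pow {R : Type*} [CommRing R] (m j : ℕ) :
    coeff m (X ^ j * mk 1 ^ (j + 1) : R⟦X⟧) = m.choose j := by
  rw [mk_one_pow_eq_mk_choose_add R j, coeff_X_pow_mul']
  split_ifs with h
  · rw [coeff_mk, Nat.add_sub_cancel' h]
  · rw [Nat.choose_eq_zero_of_lt (not_le.1 h), Nat.cast_zero]

theorem polylogDivX_neg_eq_sum {k J : ℕ} (hJ : k < J) :
    polylogDivX (-(k : ℤ)) = ∑ j ∈ Finset.range J,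
      factorialStirling k j • (X ^ j * (mk 1 : ℚ⟦X⟧) ^ (j + 1)) := by
  ext m
  simp only [map_sum, map_nsmul, coeff_X_pow_mul_mk_one_pow]
  simp only [nsmul_eq_mul, sum_factorialStirling_mul_choose m hJ]
  simp [polylogDivX]

theorem hasSubst_oneSubExpNeg : HasSubst oneSubExpNeg := by
  apply HasSubst.of_constantCoeff_zero'
  rw [oneSubExpNeg, map_sub, ← coeff_zero_eq_constantCoeff_apply (evalNegHom _), evalNegHom,
    coeff_rescale]
  simp

theorem oneSubExpNeg_mul_exp : oneSubExpNeg * exp ℚ = exp ℚ - 1 := by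
  rw [oneSubExpNeg]
  linear_combination -exp_mul_exp_neg_eq_one (A := ℚ)

theorem subst_oneSubExpNeg_mk_one : (mk 1 : ℚ⟦X⟧).subst oneSubExpNeg = exp ℚ := by
  have inv_eq := congrArg (substAlgHom hasSubst_oneSubExpNeg) (mk_one_mul_one_sub_eq_one ℚ)
  simp only [map_mul, map_sub, map_one, coe_substAlgHom, subst_X hasSubst_oneSubExpNeg] at inv_eq
  linear_combination exp ℚ * inv_eq + (mk 1 : ℚ⟦X⟧).subst oneSubExpNeg * oneSubExpNeg_mul_exp

theorem subst_oneSubExpNeg_polylogDivX_neg {k J : ℕ} (hJ : k < J) :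
    (polylogDivX (-(k : ℤ))).subst oneSubExpNeg = ∑ j ∈ Finset.range J,
      factorialStirling k j • (exp ℚ * (exp ℚ - 1) ^ j) := by
  rw [polylogDivX_neg_eq_sum hJ, ← coe_substAlgHom hasSubst_oneSubExpNeg, map_sum]
  refine Finset.sum_congr rfl fun j _ => ?_
  rw [map_nsmul, map_mul, map_pow, map_pow, coe_substAlgHom, subst_X hasSubst_oneSubExpNeg,
    subst_oneSubExpNeg_mk_one, ← oneSubExpNeg_mul_exp]
  ring

theorem polyBernoulli_neg (n : ℕ) {k J : ℕ} (hJ : k < J) :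
    polyBernoulli (-(k : ℤ)) n =
      ∑ j ∈ Finset.range J, (factorialStirling k j : ℚ) * factorialStirling n j := by
  simp only [polyBernoulli, subst_oneSubExpNeg_polylogDivX_neg hJ, map_sum, map_nsmul,
    Finset.mul_sum, mul_smul_comm, factorial_mul_coeff_exp_mul_exp_sub_one_pow]
  simp only [nsmul_eq_mul]

end PolyBernoulli

section BinomialTransform

open PowerSeries

/-- The binomial transform `∑ₙ aₙ Xⁿ ↦ ∑ₙ (∑ᵢ (n choose i) aᵢ) Xⁿ` of ordinary generating
functions. -/
noncomputable def binomialTransform (R : Type*) [CommRing R] : R⟦X⟧ →ₗ[R] R⟦X⟧ where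
  toFun f := mk fun n => ∑ i ∈ Finset.range (n + 1), (n.choose i : R) * coeff i f
  map_add' f g := by ext; simp [mul_add, Finset.sum_add_distrib]
  map_smul' c f := by ext; simp [Finset.mul_sum, mul_left_comm]

variable {R : Type*} [CommRing R]

theorem coeff_binomialTransform (f : R⟦X⟧) (n : ℕ) :
    coeff n (binomialTransform R f) = ∑ i ∈ Finset.range (n + 1), (n.choose i : R) * coeff i f :=
  coeff_mk n fun n => ∑ i ∈ Finset.range (n + 1), (n.choose i : R) * coeff i f

theorem binomialTransform_one : binomialTransform R 1 = mk 1 := by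
  ext n
  simp [coeff_binomialTransform, coeff_one]

theorem one_sub_X_mul_binomialTransform_X_mul (f : R⟦X⟧) :
    (1 - X) * binomialTransform R (X * f) = X * binomialTransform R f := by
  ext n
  rcases n with _ | n
  · simp only [sub_mul, one_mul, map_sub, coeff_zero_X_mul, coeff_binomialTransform]
    simp
  · simp only [sub_mul, one_mul, map_sub, coeff_succ_X_mul, coeff_binomialTransform]
    rw [Finset.sum_choose_succ_mul fun i _ => coeff i (X * f), add_sub_cancel_left]
    simp only [coeff_succ_X_mul]

theorem one_sub_X_mul_binomialTransform_one_sub_mul (a : R) (f : R⟦X⟧) :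
    (1 - X) * binomialTransform R ((1 - C a * X) * f) =
      (1 - C (a + 1) * X) * binomialTransform R f := by
  have transform_eq : binomialTransform R ((1 - C a * X) * f) =
      binomialTransform R f - C a * binomialTransform R (X * f) := by
    rw [sub_mul, one_mul, mul_assoc, ← smul_eq_C_mul, map_sub, map_smul, smul_eq_C_mul]
  rw [transform_eq, map_add, map_one]
  linear_combination -C a * one_sub_X_mul_binomialTransform_X_mul f

theorem one_sub_X_sq_mul_binomialTransform_one_sub_sq_mul (a : R) (f : R⟦X⟧) :
    (1 - X) ^ 2 * binomialTransform R ((1 - C a * X) ^ 2 * f) =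
      (1 - C (a + 1) * X) ^ 2 * binomialTransform R f := by
  rw [sq (1 - C a * X), mul_assoc]
  linear_combination (1 - X) * one_sub_X_mul_binomialTransform_one_sub_mul a ((1 - C a * X) * f) +
    (1 - C (a + 1) * X) * one_sub_X_mul_binomialTransform_one_sub_mul a f

theorem coeff_binomialTransform_of_X_pow_dvd {N : ℕ} {f : R⟦X⟧} (hf : X ^ N ∣ f) :
    coeff N (binomialTransform R f) = coeff N f := by
  rw [coeff_binomialTransform, Finset.sum_range_succ, Finset.sum_eq_zero, zero_add,
    Nat.choose_self, Nat.cast_one, one_mul]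
  intro i hi
  rw [X_pow_dvd_iff.1 hf i (Finset.mem_range.1 hi), mul_zero]

theorem X_pow_dvd_of_X_pow_dvd_mul_sub_binomialTransform [NoZeroDivisors R] {u f : R⟦X⟧} {N : ℕ}
    (hu : constantCoeff u ≠ 1) (h : X ^ N ∣ u * f - binomialTransform R f) : X ^ N ∣ f := by
  induction N with
  | zero => simp
  | succ N ih =>
    have hN : X ^ N ∣ f := ih ((pow_dvd_pow X N.le_succ).trans h)
    have coeff_eq : (constantCoeff u - 1) * coeff N f = 0 := by
      obtain ⟨g, rfl⟩ := hN
      have := X_pow_dvd_iff.1 h N N.lt_succ_self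
      rw [map_sub, coeff_binomialTransform_of_X_pow_dvd (dvd_mul_right _ _), mul_left_comm] at this
      simpa [coeff_X_pow_mul', sub_mul] using this
    refine X_pow_dvd_iff.2 fun i hi => ?_
    rcases Nat.lt_succ_iff_lt_or_eq.1 hi with hi | rfl
    · exact X_pow_dvd_iff.1 hN i hi
    · exact (mul_eq_zero.1 coeff_eq).resolve_left (sub_ne_zero.2 hu)

variable (R) in
/-- The ordinary generating function of `n ↦ factorialStirling n j`. -/
noncomputable def stirlingSeries (j : ℕ) : R⟦X⟧ := mk fun n => (factorialStirling n j : R)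

theorem stirlingSeries_zero : stirlingSeries R 0 = mk 1 := by
  ext n
  simp [stirlingSeries, factorialStirling_zero_right]

theorem one_sub_mul_stirlingSeries_succ (j : ℕ) :
    (1 - C (j + 2 : R) * X) * stirlingSeries R (j + 1) =
      C (j + 1 : R) * X * stirlingSeries R j := by
  ext n
  rw [sub_mul, one_mul, map_sub, mul_assoc, mul_assoc, coeff_C_mul, coeff_C_mul]
  rcases n with _ | n
  · simp [stirlingSeries, factorialStirling_eq_zero_of_lt]
  · simp only [coeff_succ_X_mul, stirlingSeries, coeff_mk, factorialStirling_succ_succ]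
    push_cast
    ring

theorem X_pow_dvd_stirlingSeries (j : ℕ) : X ^ j ∣ stirlingSeries R j :=
  X_pow_dvd_iff.2 fun n hn => by simp [stirlingSeries, factorialStirling_eq_zero_of_lt hn]

theorem isUnit_one_sub_C_mul_X (a : R) : IsUnit (1 - C a * X : R⟦X⟧) :=
  isUnit_iff_constantCoeff.2 (by simp)

theorem one_sub_sq_mul_binomialTransform_stirlingSeries_sq (j : ℕ) :
    (1 - C (j + 2 : R) * X) ^ 2 * binomialTransform R (stirlingSeries R j ^ 2) =
      (1 - X) ^ 3 * stirlingSeries R j ^ 2 := by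
  have mk_one_mul := mk_one_mul_one_sub_eq_one R
  induction j with
  | zero =>
    have shift := one_sub_X_sq_mul_binomialTransform_one_sub_sq_mul (1 : R) (mk 1 ^ 2)
    have h1 : (1 - X) ^ 2 * mk 1 ^ 2 = (1 : R⟦X⟧) := by
      linear_combination (mk 1 * (1 - X) + 1) * mk_one_mul
    rw [map_one, one_mul, h1, binomialTransform_one, one_add_one_eq_two] at shift
    rw [stirlingSeries_zero, Nat.cast_zero, zero_add]
    linear_combination -shift + (1 - X) * mk_one_mul - (1 - X) * h1
  | succ j ih =>
    have succ_eq := congrArg (· ^ 2) (one_sub_mul_stirlingSeries_succ (R := R) j)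
    have transform_eq : binomialTransform R ((C (j + 1 : R) * X * stirlingSeries R j) ^ 2) =
        C ((j + 1 : R) ^ 2) * binomialTransform R (X * (X * stirlingSeries R j ^ 2)) := by
      rw [← smul_eq_C_mul _ ((j + 1 : R) ^ 2), ← map_smul, smul_eq_C_mul, map_pow C]
      congr 1
      ring
    have shift := one_sub_X_sq_mul_binomialTransform_one_sub_sq_mul (j + 2 : R)
      (stirlingSeries R (j + 1) ^ 2)
    rw [← mul_pow, succ_eq, transform_eq, map_pow] at shift
    rw [Nat.cast_succ, add_right_comm]
    refine ((isUnit_one_sub_C_mul_X (j + 2 : R)).pow 2).mul_left_cancel ?_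
    linear_combination -(1 - C (j + 2 : R) * X) ^ 2 * shift + C (j + 1 : R) ^ 2 * X ^ 2 * ih -
      (1 - X) ^ 3 * succ_eq + C (j + 1 : R) ^ 2 * (1 - C (j + 2 : R) * X) ^ 2 *
        ((1 - X) * one_sub_X_mul_binomialTransform_X_mul (X * stirlingSeries R j ^ 2) +
          X * one_sub_X_mul_binomialTransform_X_mul (stirlingSeries R j ^ 2))

theorem telescope_stirlingSeries_sq (j : ℕ) :
    (4 - 2 * X) * stirlingSeries R j ^ 2 - binomialTransform R (stirlingSeries R j ^ 2) =
      (3 - C (2 * j + 3 : R) * X) * stirlingSeries R j ^ 2 -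
        (3 - C (2 * (j + 1 : ℕ) + 3 : R) * X) * stirlingSeries R (j + 1) ^ 2 := by
  have transform_eq := one_sub_sq_mul_binomialTransform_stirlingSeries_sq (R := R) j
  have succ_eq := congrArg (· ^ 2) (one_sub_mul_stirlingSeries_succ (R := R) j)
  refine ((isUnit_one_sub_C_mul_X (j + 2 : R)).pow 2).mul_left_cancel ?_
  simp only [map_add, map_mul, map_natCast, map_ofNat, map_one] at transform_eq succ_eq ⊢
  push_cast
  linear_combination -transform_eq + (3 - (2 * j + 5) * X) * succ_eq

theorem four_sub_two_X_mul_sum_stirlingSeries_sq (J : ℕ) :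
    (4 - 2 * X) * ∑ j ∈ Finset.range J, stirlingSeries R j ^ 2 -
        binomialTransform R (∑ j ∈ Finset.range J, stirlingSeries R j ^ 2) =
      3 * mk 1 - (3 - C (2 * J + 3 : R) * X) * stirlingSeries R J ^ 2 := by
  have first_term : (3 - C (2 * (0 : ℕ) + 3 : R) * X) * stirlingSeries R 0 ^ 2 = 3 * mk 1 := by
    rw [stirlingSeries_zero, Nat.cast_zero, mul_zero, zero_add, map_ofNat]
    linear_combination 3 * mk 1 * mk_one_mul_one_sub_eq_one R
  rw [map_sum, Finset.mul_sum, ← Finset.sum_sub_distrib,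
    Finset.sum_congr rfl fun j _ => telescope_stirlingSeries_sq j, Finset.sum_range_sub',
    first_term]

theorem coeff_sum_stirlingSeries_sq {K : Type*} [Field K] [CharZero K] (n : ℕ) :
    coeff n (∑ j ∈ Finset.range (n + 1), stirlingSeries K j ^ 2) =
      ((∑ k ∈ Finset.range (n + 1), polyBernoulli (-(k : ℤ)) (n - k) : ℚ) : K) := by
  simp only [map_sum, sq, coeff_mul, Finset.Nat.sum_antidiagonal_eq_sum_range_succ_mk,
    stirlingSeries, coeff_mk]
  rw [Finset.sum_comm, Rat.cast_sum]
  refine Finset.sum_congr rfl fun k hk => ?_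
  rw [polyBernoulli_neg _ (Finset.mem_range.1 hk)]
  push_cast
  rfl

theorem three_mul_eq_sum_polyBernoulli_of_recurrence {K : Type*} [Field K] [CharZero K] {a : ℕ → K}
    (zero : a 0 = 0)
    (recurrence : ∀ n, 4 * a (n + 1) - ∑ i ∈ Finset.range (n + 1), (n.choose i : K) * a (i + 1) =
      2 * a n + 1) (n : ℕ) :
    3 * a (n + 1) =
      ((∑ k ∈ Finset.range (n + 1), polyBernoulli (-(k : ℤ)) (n - k) : ℚ) : K) := by
  set f : K⟦X⟧ := mk fun n => a (n + 1)
  have series_eq : (4 - 2 * X) * f - binomialTransform K f = mk 1 := by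
    ext n
    rw [← map_ofNat C, sub_mul, mul_assoc, ← map_ofNat C 2, map_sub, map_sub, coeff_C_mul,
      coeff_C_mul, coeff_binomialTransform]
    simp only [f, coeff_mk, Pi.one_apply]
    rcases n with _ | n
    · simpa [zero] using recurrence 0
    · rw [coeff_succ_X_mul, coeff_mk]
      linear_combination recurrence (n + 1)
  have transform_eq : (4 - 2 * X) * (3 * f - ∑ j ∈ Finset.range (n + 1), stirlingSeries K j ^ 2) -
      binomialTransform K (3 * f - ∑ j ∈ Finset.range (n + 1), stirlingSeries K j ^ 2) =
        (3 - C (2 * (n + 1 : ℕ) + 3 : K) * X) * stirlingSeries K (n + 1) ^ 2 := by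
    have three_mul : binomialTransform K (3 * f) = 3 * binomialTransform K f := by
      simpa only [smul_eq_C_mul, map_ofNat] using map_smul (binomialTransform K) (3 : K) f
    rw [map_sub, three_mul]
    linear_combination 3 * series_eq - four_sub_two_X_mul_sum_stirlingSeries_sq (R := K) (n + 1)
  have X_pow_dvd : X ^ (n + 1) ∣ 3 * f - ∑ j ∈ Finset.range (n + 1), stirlingSeries K j ^ 2 := by
    have constantCoeff_ne : constantCoeff (4 - 2 * X : K⟦X⟧) ≠ 1 := by
      rw [map_sub, map_ofNat]
      norm_num
    refine X_pow_dvd_of_X_pow_dvd_mul_sub_binomialTransform constantCoeff_ne ?_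
    rw [transform_eq]
    exact ((X_pow_dvd_stirlingSeries _).trans (dvd_pow_self _ two_ne_zero)).mul_left _
  have coeff_eq := X_pow_dvd_iff.1 X_pow_dvd n n.lt_succ_self
  rw [map_sub, coeff_sum_stirlingSeries_sq, sub_eq_zero] at coeff_eq
  rw [← coeff_eq, ← map_ofNat C, coeff_C_mul, coeff_mk]

end BinomialTransform
section MellinContinuation

open Filter Topology MeasureTheory Set Asymptotics

variable {E : Type*} [NormedAddCommGroup E] [NormedSpace ℂ E]

/-- A sequence of functions on `[0, ∞)`, each the negative of the derivative of the one before it,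
all of which decay exponentially at rate `c`. -/
structure IsDecayingDerivSeq (c : ℝ) (h : ℕ → ℝ → E) : Prop where
  pos : 0 < c
  hasDerivAt : ∀ m t, 0 ≤ t → HasDerivAt (h m) (-h (m + 1) t) t
  isBigO_exp : ∀ m, h m =O[atTop] fun t => Real.exp (-c * t)

namespace IsDecayingDerivSeq

variable {c : ℝ} {h : ℕ → ℝ → E}

theorem locallyIntegrableOn (H : IsDecayingDerivSeq c h) (m : ℕ) :
    LocallyIntegrableOn (h m) (Ioi 0) :=
  ContinuousOn.locallyIntegrableOn
    (fun t ht => (H.hasDerivAt m t (le_of_lt ht)).continuousAt.continuousWithinAt)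
    measurableSet_Ioi

theorem isBigO_rpow_nhdsGT_zero (H : IsDecayingDerivSeq c h) (m : ℕ) :
    h m =O[𝓝[>] 0] fun t : ℝ => t ^ (-(0 : ℝ)) := by
  simpa only [neg_zero, Real.rpow_zero] using
    (H.hasDerivAt m 0 le_rfl).continuousAt.continuousWithinAt.tendsto.isBigO_one ℝ

theorem mellinConvergent (H : IsDecayingDerivSeq c h) (m : ℕ) {s : ℂ} (hs : 0 < s.re) :
    MellinConvergent (h m) s :=
  mellinConvergent_of_isBigO_rpow_exp H.pos (H.locallyIntegrableOn m) (H.isBigO_exp m)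
    (H.isBigO_rpow_nhdsGT_zero m) hs

theorem differentiableAt_mellin (H : IsDecayingDerivSeq c h) (m : ℕ) {s : ℂ} (hs : 0 < s.re) :
    DifferentiableAt ℂ (mellin (h m)) s :=
  mellin_differentiableAt_of_isBigO_rpow_exp H.pos (H.locallyIntegrableOn m) (H.isBigO_exp m)
    (H.isBigO_rpow_nhdsGT_zero m) hs

theorem tendsto_cpow_smul_atTop (H : IsDecayingDerivSeq c h) (m : ℕ) (s : ℂ) :
    Tendsto (fun t : ℝ => (t : ℂ) ^ s • h m t) atTop (𝓝 0) := by
  have cpow_isBigO : (fun t : ℝ => (t : ℂ) ^ s) =O[atTop] fun t => t ^ s.re :=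
    IsBigO.of_norm_eventuallyLE <| (eventually_gt_atTop 0).mono fun t ht =>
      (Complex.norm_cpow_eq_rpow_re_of_pos ht s).le
  exact (cpow_isBigO.smul (H.isBigO_exp m)).trans_tendsto
    (tendsto_rpow_mul_exp_neg_mul_atTop_nhds_zero s.re c H.pos)

theorem mellin_succ_add_one [CompleteSpace E] (H : IsDecayingDerivSeq c h) (m : ℕ) {s : ℂ}
    (hs : 0 < s.re) : mellin (h (m + 1)) (s + 1) = s • mellin (h m) s := by
  have s_ne_zero : s ≠ 0 := fun h0 => by simp [h0] at hs
  have integrable : IntegrableOn (fun t : ℝ => (t : ℂ) ^ (s - 1) • h m t) (Ioi 0) :=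
    H.mellinConvergent m hs
  have integrable_succ : IntegrableOn (fun t : ℝ => (t : ℂ) ^ (s + 1 - 1) • h (m + 1) t) (Ioi 0) :=
    H.mellinConvergent (m + 1) (by simpa using hs.trans (lt_add_one _))
  have hasDerivAt (t : ℝ) (ht : t ∈ Ioi 0) : HasDerivAt (fun t : ℝ => (t : ℂ) ^ s • h m t)
      (s • (t : ℂ) ^ (s - 1) • h m t - (t : ℂ) ^ (s + 1 - 1) • h (m + 1) t) t := by
    refine ((hasDerivAt_ofReal_cpow_const (ne_of_gt ht) s_ne_zero).smul
      (H.hasDerivAt m t (le_of_lt ht))).congr_deriv ?_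
    rw [add_sub_cancel_right, smul_neg, smul_smul]
    abel
  have continuousAt : ContinuousAt (fun t : ℝ => (t : ℂ) ^ s • h m t) 0 :=
    (Complex.continuousAt_ofReal_cpow_const 0 s (Or.inl hs)).smul
      (H.hasDerivAt m 0 le_rfl).continuousAt
  have integral_eq := integral_Ioi_of_hasDerivAt_of_tendsto continuousAt.continuousWithinAt
    hasDerivAt ((integrable.fun_smul s).sub integrable_succ) (H.tendsto_cpow_smul_atTop m s)
  rw [integral_sub (integrable.fun_smul s) integrable_succ, integral_smul, Complex.ofReal_zero,
    Complex.zero_cpow s_ne_zero, zero_smul, sub_zero, sub_eq_zero] at integral_eq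
  exact integral_eq.symm

theorem mellin_succ_one [CompleteSpace E] (H : IsDecayingDerivSeq c h) (m : ℕ) :
    mellin (h (m + 1)) 1 = h m 0 := by
  have integrable : IntegrableOn (h (m + 1)) (Ioi 0) := by
    simpa [MellinConvergent] using H.mellinConvergent (m + 1) (s := 1) (by simp)
  have tendsto_zero : Tendsto (h m) atTop (𝓝 0) := by
    simpa using H.tendsto_cpow_smul_atTop m 0
  have integral_eq := integral_Ioi_of_hasDerivAt_of_tendsto'
    (fun t ht => H.hasDerivAt m t ht) integrable.neg tendsto_zero
  rw [integral_neg, zero_sub, neg_inj] at integral_eq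
  simpa [mellin] using integral_eq

end IsDecayingDerivSeq

/-- The normalized Mellin transform of `h m` at `s + m`; for an `IsDecayingDerivSeq` it does not
depend on `m` as long as `0 < re (s + m)`. -/
noncomputable def shiftedMellin (h : ℕ → ℝ → E) (m : ℕ) (s : ℂ) : E :=
  (Complex.Gamma (s + m))⁻¹ • mellin (h m) (s + m)

/-- The entire continuation of `s ↦ Γ(s)⁻¹ mellin (h 0) s` for an `IsDecayingDerivSeq`, with
`⌊-s.re⌋₊ + 1` as a number `m` of derivatives for which `0 < re (s + m)`. -/
noncomputable def entireMellin (h : ℕ → ℝ → E) (s : ℂ) : E := shiftedMellin h (⌊-s.re⌋₊ + 1) s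

namespace IsDecayingDerivSeq

variable {c : ℝ} {h : ℕ → ℝ → E}

theorem differentiableAt_shiftedMellin (H : IsDecayingDerivSeq c h) (m : ℕ) {s : ℂ}
    (hs : 0 < s.re + m) : DifferentiableAt ℂ (shiftedMellin h m) s := by
  have hs' : 0 < (s + m).re := by simpa using hs
  exact ((Complex.differentiable_one_div_Gamma _).comp s (by fun_prop)).smul
    (DifferentiableAt.comp (g := mellin (h m)) s (H.differentiableAt_mellin m hs') (by fun_prop))

variable [CompleteSpace E]

theorem shiftedMellin_succ (H : IsDecayingDerivSeq c h) (m : ℕ) {s : ℂ} (hs : 0 < s.re + m) :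
    shiftedMellin h (m + 1) s = shiftedMellin h m s := by
  have hs' : 0 < (s + m).re := by simpa using hs
  have s_add_ne_zero : s + m ≠ 0 := fun h0 => by simp [h0] at hs'
  rw [shiftedMellin, shiftedMellin, Nat.cast_succ, ← add_assoc, H.mellin_succ_add_one m hs',
    Complex.Gamma_add_one _ s_add_ne_zero, smul_smul, mul_inv_rev,
    inv_mul_cancel_right₀ s_add_ne_zero]

theorem shiftedMellin_eq_of_le (H : IsDecayingDerivSeq c h) {m n : ℕ} (hmn : m ≤ n) {s : ℂ}
    (hs : 0 < s.re + m) : shiftedMellin h n s = shiftedMellin h m s := by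
  induction n, hmn using Nat.le_induction with
  | base => rfl
  | succ n hn ih =>
    have : (m : ℝ) ≤ n := by exact_mod_cast hn
    rw [H.shiftedMellin_succ n (by linarith), ih]

theorem entireMellin_eq_shiftedMellin (H : IsDecayingDerivSeq c h) (m : ℕ) {s : ℂ}
    (hs : 0 < s.re + m) : entireMellin h s = shiftedMellin h m s := by
  have re_add_pos : 0 < s.re + (⌊-s.re⌋₊ + 1 : ℕ) := by
    have := Nat.lt_floor_add_one (-s.re)
    push_cast
    linarith
  rcases le_total m (⌊-s.re⌋₊ + 1) with hm | hm
  · exact H.shiftedMellin_eq_of_le hm hs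
  · exact (H.shiftedMellin_eq_of_le hm re_add_pos).symm

theorem differentiable_entireMellin (H : IsDecayingDerivSeq c h) :
    Differentiable ℂ (entireMellin h) := by
  intro s
  obtain ⟨m, hm⟩ := exists_nat_gt (-s.re)
  have hs : 0 < s.re + m := by linarith
  refine (H.differentiableAt_shiftedMellin m hs).congr_of_eventuallyEq ?_
  have eventually_pos : ∀ᶠ z : ℂ in 𝓝 s, 0 < z.re + m :=
    (Complex.continuous_re.add continuous_const).continuousAt.eventually_const_lt hs
  exact eventually_pos.mono fun z hz => H.entireMellin_eq_shiftedMellin m hz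

theorem entireMellin_eq_mellin (H : IsDecayingDerivSeq c h) {s : ℂ} (hs : 0 < s.re) :
    entireMellin h s = (Complex.Gamma s)⁻¹ • mellin (h 0) s := by
  rw [H.entireMellin_eq_shiftedMellin 0 (by simpa using hs), shiftedMellin, Nat.cast_zero, add_zero]

theorem entireMellin_neg_natCast (H : IsDecayingDerivSeq c h) (m : ℕ) :
    entireMellin h (-(m : ℂ)) = h m 0 := by
  rw [H.entireMellin_eq_shiftedMellin (m + 1) (by simp), shiftedMellin, Nat.cast_succ,
    neg_add_cancel_left, H.mellin_succ_one, Complex.Gamma_one, inv_one, one_smul]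

end IsDecayingDerivSeq

end MellinContinuation

section LehmerKernel

open Real Polynomial

/-- The function `θ ↦ (θ - σ) tan (θ/2)` after `m` applications of the operator `tan (θ/2) d/dθ`,
in terms of the Lehmer polynomials `p_{m-1}` and `q_{m-1}`. -/
noncomputable def lehmerKernel (σ : ℝ) (m : ℕ) (θ : ℝ) : ℝ :=
  ((θ - σ) * tan (θ / 2) * aeval (sin (θ / 2) ^ 2) (lehmerPair m).2 +
    2 * sin (θ / 2) ^ 2 * aeval (sin (θ / 2) ^ 2) (lehmerPair m).1) *
      ((2 * cos (θ / 2) ^ 2)⁻¹) ^ m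

theorem lehmerKernel_zero_right (σ : ℝ) (m : ℕ) : lehmerKernel σ m 0 = 0 := by
  simp [lehmerKernel]

theorem lehmerKernel_zero_left (σ θ : ℝ) : lehmerKernel σ 0 θ = (θ - σ) * tan (θ / 2) := by
  simp [lehmerKernel, lehmerPair]

theorem lehmerKernel_self (σ : ℝ) (m : ℕ) :
    lehmerKernel σ m σ = 2 * sin (σ / 2) ^ 2 * aeval (sin (σ / 2) ^ 2) (lehmerPair m).1 *
      ((2 * cos (σ / 2) ^ 2)⁻¹) ^ m := by
  simp [lehmerKernel]

theorem two_mul_cos_half_sq_mul_lehmerKernel_one (σ : ℝ) {θ : ℝ} (hθ : cos (θ / 2) ≠ 0) :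
    2 * cos (θ / 2) ^ 2 * lehmerKernel σ 1 θ = lehmerKernel σ 0 θ + 2 * sin (θ / 2) ^ 2 := by
  simp [lehmerKernel, lehmerPair, field]

theorem differentiableAt_lehmerKernel (σ : ℝ) (m : ℕ) {θ : ℝ} (hθ : cos (θ / 2) ≠ 0) :
    DifferentiableAt ℝ (lehmerKernel σ m) θ := by
  have tan_half : DifferentiableAt ℝ (fun θ => tan (θ / 2)) θ :=
    DifferentiableAt.comp (g := tan) θ (differentiableAt_tan.2 hθ) (by fun_prop)
  have inv_cos_sq : DifferentiableAt ℝ (fun θ => (2 * cos (θ / 2) ^ 2)⁻¹) θ :=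
    DifferentiableAt.inv (by fun_prop) (by positivity)
  have aeval_sin_sq (p : ℤ[X]) : DifferentiableAt ℝ (fun θ => aeval (sin (θ / 2) ^ 2) p) θ :=
    DifferentiableAt.comp (g := fun x => aeval x p) θ p.differentiableAt_aeval (by fun_prop)
  unfold lehmerKernel
  fun_prop

variable {θ : ℝ → ℝ} {t : ℝ}

theorem hasDerivAt_sin_half_sq_comp (hcos : cos (θ t / 2) ≠ 0)
    (hθ : HasDerivAt θ (-tan (θ t / 2)) t) :
    HasDerivAt (fun t => sin (θ t / 2) ^ 2) (-sin (θ t / 2) ^ 2) t := by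
  refine ((hθ.div_const 2).sin.pow 2).congr_deriv ?_
  linear_combination -sin (θ t / 2) * tan_mul_cos hcos

theorem hasDerivAt_tan_half_comp (hcos : cos (θ t / 2) ≠ 0)
    (hθ : HasDerivAt θ (-tan (θ t / 2)) t) :
    HasDerivAt (fun t => tan (θ t / 2)) (-(tan (θ t / 2) * (2 * cos (θ t / 2) ^ 2)⁻¹)) t := by
  refine ((hasDerivAt_tan hcos).comp t (hθ.div_const 2)).congr_deriv ?_
  field

theorem hasDerivAt_inv_two_mul_cos_half_sq_pow_comp (hcos : cos (θ t / 2) ≠ 0)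
    (hθ : HasDerivAt θ (-tan (θ t / 2)) t) (m : ℕ) :
    HasDerivAt (fun t => ((2 * cos (θ t / 2) ^ 2)⁻¹) ^ m)
      (-(2 * m * sin (θ t / 2) ^ 2 * ((2 * cos (θ t / 2) ^ 2)⁻¹) ^ (m + 1))) t := by
  have base := ((hasDerivAt_sin_half_sq_comp hcos hθ).const_sub 1).const_mul 2
  simp only [← cos_sq'] at base
  refine ((base.fun_inv (by positivity)).fun_pow m).congr_deriv ?_
  rcases m with _ | m
  · simp
  · rw [Nat.add_sub_cancel]
    generalize 2 * cos (θ t / 2) ^ 2 = c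
    ring

theorem hasDerivAt_lehmerKernel_comp (σ : ℝ) (m : ℕ) (hcos : cos (θ t / 2) ≠ 0)
    (hθ : HasDerivAt θ (-tan (θ t / 2)) t) :
    HasDerivAt (fun t => lehmerKernel σ m (θ t)) (-lehmerKernel σ (m + 1) (θ t)) t := by
  have sin_sq := hasDerivAt_sin_half_sq_comp hcos hθ
  have aeval_comp (p : ℤ[X]) := (p.hasDerivAt_aeval (sin (θ t / 2) ^ 2)).comp t sin_sq
  refine (((((hθ.sub_const σ).mul (hasDerivAt_tan_half_comp hcos hθ)).mul
    (aeval_comp (lehmerPair m).2)).add ((sin_sq.const_mul 2).mul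
      (aeval_comp (lehmerPair m).1))).mul
        (hasDerivAt_inv_two_mul_cos_half_sq_pow_comp hcos hθ m)).congr_deriv ?_
  have tan_sq : tan (θ t / 2) ^ 2 = 2 * sin (θ t / 2) ^ 2 * (2 * cos (θ t / 2) ^ 2)⁻¹ := by
    rw [tan_eq_sin_div_cos]
    field
  have inv_mul : 2 * (1 - sin (θ t / 2) ^ 2) * (2 * cos (θ t / 2) ^ 2)⁻¹ = 1 := by
    rw [← cos_sq', mul_inv_cancel₀ (by positivity)]
  simp only [lehmerKernel, lehmerPair, Function.comp_apply, map_add, map_mul, map_sub, map_one,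
    map_natCast, map_ofNat, aeval_X, Pi.add_apply, Pi.mul_apply, pow_succ _ m]
  generalize (2 * cos (θ t / 2) ^ 2)⁻¹ = w at *
  generalize sin (θ t / 2) ^ 2 = x at *
  generalize tan (θ t / 2) = T at *
  generalize aeval x (lehmerPair m).1 = P at *
  generalize aeval x (lehmerPair m).2 = Q at *
  generalize aeval x (derivative (lehmerPair m).1) = P' at *
  generalize aeval x (derivative (lehmerPair m).2) = Q' at *
  linear_combination -Q * w ^ m * tan_sq + ((θ t - σ) * T * x * Q' * w ^ m +
    2 * x * P * w ^ m + 2 * x ^ 2 * P' * w ^ m) * inv_mul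

end LehmerKernel

section LogSineAngle

open Real Set Filter Topology MeasureTheory Asymptotics

/-- The angle `θ ∈ (0, σ]` with `-2 log (sin (θ/2) / sin (σ/2)) = t`, for `0 ≤ t`. -/
noncomputable def logSineAngle (σ t : ℝ) : ℝ := 2 * arcsin (sin (σ / 2) * exp (-t / 2))

variable {σ t : ℝ}

theorem sin_half_mem_Ioo (hσ : σ ∈ Ioo 0 π) : sin (σ / 2) ∈ Ioo 0 1 := by
  refine ⟨sin_pos_of_mem_Ioo ⟨by linarith [hσ.1], by linarith [hσ.1, hσ.2]⟩, ?_⟩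
  rw [← sin_pi_div_two]
  exact sin_lt_sin_of_lt_of_le_pi_div_two (by linarith [hσ.1, pi_pos]) le_rfl (by linarith [hσ.2])

theorem cos_half_pos (hσ : σ ∈ Ioo 0 π) : 0 < cos (σ / 2) :=
  cos_pos_of_mem_Ioo ⟨by linarith [hσ.1, pi_pos], by linarith [hσ.2]⟩

theorem logSineAngle_zero (hσ : σ ∈ Ioo 0 π) : logSineAngle σ 0 = σ := by
  rw [logSineAngle, neg_zero, zero_div, exp_zero, mul_one,
    arcsin_sin (by linarith [hσ.1, pi_pos]) (by linarith [hσ.2]), mul_div_cancel₀ _ two_ne_zero]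

theorem logSineAngle_mem_Ioc (hσ : σ ∈ Ioo 0 π) (ht : 0 ≤ t) : logSineAngle σ t ∈ Ioc 0 σ := by
  have sin_pos := (sin_half_mem_Ioo hσ).1
  refine ⟨mul_pos two_pos (arcsin_pos.2 (by positivity)), ?_⟩
  calc logSineAngle σ t ≤ logSineAngle σ 0 := by
        unfold logSineAngle
        gcongr
    _ = σ := logSineAngle_zero hσ

theorem logSineAngle_mem_Ioo_pi (hσ : σ ∈ Ioo 0 π) (ht : 0 ≤ t) : logSineAngle σ t ∈ Ioo 0 π :=
  Ioc_subset_Ioo_right hσ.2 (logSineAngle_mem_Ioc hσ ht)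

theorem sin_half_logSineAngle (hσ : σ ∈ Ioo 0 π) (ht : 0 ≤ t) :
    sin (logSineAngle σ t / 2) = sin (σ / 2) * exp (-t / 2) := by
  obtain ⟨sin_pos, sin_lt⟩ := sin_half_mem_Ioo hσ
  have mul_pos : 0 < sin (σ / 2) * exp (-t / 2) := by positivity
  rw [logSineAngle, mul_div_cancel_left₀ _ two_ne_zero, sin_arcsin (by linarith)]
  exact mul_le_one₀ sin_lt.le (exp_pos _).le (exp_le_one_iff.2 (by linarith))

theorem sin_half_logSineAngle_sq (hσ : σ ∈ Ioo 0 π) (ht : 0 ≤ t) :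
    sin (logSineAngle σ t / 2) ^ 2 = sin (σ / 2) ^ 2 * exp (-t) := by
  rw [sin_half_logSineAngle hσ ht, mul_pow, ← exp_nat_mul, Nat.cast_ofNat,
    mul_div_cancel₀ _ two_ne_zero]

theorem neg_two_mul_log_sin_half_logSineAngle (hσ : σ ∈ Ioo 0 π) (ht : 0 ≤ t) :
    -2 * log (sin (logSineAngle σ t / 2) / sin (σ / 2)) = t := by
  rw [sin_half_logSineAngle hσ ht, mul_div_cancel_left₀ _ (sin_half_mem_Ioo hσ).1.ne', log_exp]
  ring

theorem logSineAngle_neg_two_mul_log_sin_half {θ : ℝ} (hσ : σ ∈ Ioo 0 π) (hθ : θ ∈ Ioo 0 π) :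
    logSineAngle σ (-2 * log (sin (θ / 2) / sin (σ / 2))) = θ := by
  have ratio_pos := div_pos (sin_half_mem_Ioo hθ).1 (sin_half_mem_Ioo hσ).1
  rw [logSineAngle, neg_mul, neg_neg, mul_div_cancel_left₀ _ two_ne_zero, exp_log ratio_pos,
    mul_div_cancel₀ _ (sin_half_mem_Ioo hσ).1.ne',
    arcsin_sin (by linarith [hθ.1, pi_pos]) (by linarith [hθ.2]), mul_div_cancel₀ _ two_ne_zero]

theorem bijOn_logSineAngle (hσ : σ ∈ Ioo 0 π) : BijOn (logSineAngle σ) (Ioi 0) (Ioo 0 σ) := by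
  refine InvOn.bijOn (f' := fun θ => -2 * log (sin (θ / 2) / sin (σ / 2)))
    ⟨fun t ht => neg_two_mul_log_sin_half_logSineAngle hσ (le_of_lt ht),
      fun θ hθ => logSineAngle_neg_two_mul_log_sin_half hσ ⟨hθ.1, hθ.2.trans hσ.2⟩⟩
    (fun t ht => ?_) fun θ hθ => ?_
  · obtain ⟨pos, le⟩ := logSineAngle_mem_Ioc hσ (le_of_lt ht)
    refine ⟨pos, lt_of_le_of_ne le fun eq => (mem_Ioi.1 ht).ne ?_⟩
    rw [← neg_two_mul_log_sin_half_logSineAngle hσ (le_of_lt ht), eq,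
      div_self (sin_half_mem_Ioo hσ).1.ne', log_one, mul_zero]
  · have sin_lt : sin (θ / 2) < sin (σ / 2) :=
      sin_lt_sin_of_lt_of_le_pi_div_two (by linarith [hθ.1, pi_pos]) (by linarith [hσ.2])
        (by linarith [hθ.2])
    have sin_pos := (sin_half_mem_Ioo ⟨hθ.1, hθ.2.trans hσ.2⟩).1
    have log_neg := log_neg (div_pos sin_pos (sin_pos.trans sin_lt))
      ((div_lt_one (sin_pos.trans sin_lt)).2 sin_lt)
    exact mem_Ioi.2 (by linarith)

theorem hasDerivAt_logSineAngle (hσ : σ ∈ Ioo 0 π) (ht : 0 ≤ t) :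
    HasDerivAt (logSineAngle σ) (-tan (logSineAngle σ t / 2)) t := by
  have mem := logSineAngle_mem_Ioo_pi hσ ht
  have sin_mem := sin_half_mem_Ioo mem
  rw [sin_half_logSineAngle hσ ht] at sin_mem
  have exp_deriv : HasDerivAt (fun t => sin (σ / 2) * exp (-t / 2))
      (-(sin (σ / 2) * exp (-t / 2) / 2)) t :=
    (((hasDerivAt_neg t).div_const 2).exp.const_mul _).congr_deriv (by ring)
  refine (((hasDerivAt_arcsin (by linarith [sin_mem.1]) sin_mem.2.ne).comp t
    exp_deriv).const_mul 2).congr_deriv ?_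
  rw [logSineAngle, mul_div_cancel_left₀ _ two_ne_zero, tan_arcsin]
  ring

end LogSineAngle

section LogSineDeriv

open Real Set Filter Topology MeasureTheory Asymptotics

/-- The `m`-th derivative, up to the sign `(-1)^m`, of `(θ - σ) tan (θ/2)` as a function of
`t ≥ 0`, where `θ = logSineAngle σ t`. -/
noncomputable def logSineDeriv (σ : ℝ) (m : ℕ) (t : ℝ) : ℝ := lehmerKernel σ m (logSineAngle σ t)

variable {σ t : ℝ}

theorem hasDerivAt_logSineDeriv (hσ : σ ∈ Ioo 0 π) (m : ℕ) (ht : 0 ≤ t) :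
    HasDerivAt (logSineDeriv σ m) (-logSineDeriv σ (m + 1) t) t :=
  hasDerivAt_lehmerKernel_comp σ m (cos_half_pos (logSineAngle_mem_Ioo_pi hσ ht)).ne'
    (hasDerivAt_logSineAngle hσ ht)

theorem isBigO_logSineDeriv (σ : ℝ) (m : ℕ) :
    logSineDeriv σ m =O[atTop] fun t => exp (-(1 / 2) * t) := by
  have arcsin_differentiableAt : DifferentiableAt ℝ (fun u => 2 * arcsin u) 0 :=
    (differentiableAt_arcsin.2 (by norm_num)).const_mul 2
  have kernel_differentiableAt :
      DifferentiableAt ℝ (fun u => lehmerKernel σ m (2 * arcsin u)) 0 :=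
    DifferentiableAt.comp (g := lehmerKernel σ m) 0
      (differentiableAt_lehmerKernel σ m (by simp)) arcsin_differentiableAt
  have kernel_isBigO : (fun u => lehmerKernel σ m (2 * arcsin u)) =O[𝓝 0] fun u => u := by
    simpa [lehmerKernel_zero_right] using kernel_differentiableAt.isBigO_sub
  have tendsto_exp : Tendsto (fun t => exp (-(1 / 2) * t)) atTop (𝓝 0) :=
    tendsto_exp_atBot.comp (tendsto_id.const_mul_atTop_of_neg (by norm_num))
  have tendsto_sin : Tendsto (fun t => sin (σ / 2) * exp (-(1 / 2) * t)) atTop (𝓝 0) := by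
    simpa using tendsto_exp.const_mul (sin (σ / 2))
  have exp_eq (t : ℝ) : exp (-t / 2) = exp (-(1 / 2) * t) := by
    congr 1
    ring
  have logSineDeriv_eq : logSineDeriv σ m =
      (fun u => lehmerKernel σ m (2 * arcsin u)) ∘ fun t => sin (σ / 2) * exp (-(1 / 2) * t) := by
    ext t
    rw [logSineDeriv, logSineAngle, exp_eq, Function.comp_apply]
  rw [logSineDeriv_eq]
  exact (kernel_isBigO.comp_tendsto tendsto_sin).trans (isBigO_const_mul_self _ _ _)

theorem isDecayingDerivSeq_logSineDeriv (hσ : σ ∈ Ioo 0 π) :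
    IsDecayingDerivSeq (1 / 2) fun m t => (logSineDeriv σ m t : ℂ) where
  pos := by norm_num
  hasDerivAt m t ht := by simpa using (hasDerivAt_logSineDeriv hσ m ht).ofReal_comp
  isBigO_exp m := Complex.isBigO_ofReal_left.2 (isBigO_logSineDeriv σ m)

theorem logSineDeriv_apply_zero (hσ : σ ∈ Ioo 0 π) (m : ℕ) :
    logSineDeriv σ m 0 = 2 * sin (σ / 2) ^ 2 * Polynomial.aeval (sin (σ / 2) ^ 2) (lehmerPair m).1 *
      ((2 * (1 - sin (σ / 2) ^ 2))⁻¹) ^ m := by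
  rw [logSineDeriv, logSineAngle_zero hσ, lehmerKernel_self, cos_sq']

theorem abs_deriv_smul_shiftedLogSineIntegrand (hσ : σ ∈ Ioo 0 π) (s : ℂ) (ht : 0 ≤ t) :
    |-tan (logSineAngle σ t / 2)| • shiftedLogSineIntegrand s σ (logSineAngle σ t) =
      (t : ℂ) ^ (s - 1 - 1) • (logSineDeriv σ 0 t : ℂ) := by
  have mem := logSineAngle_mem_Ioo_pi hσ ht
  have tan_pos : 0 < tan (logSineAngle σ t / 2) :=
    tan_pos_of_pos_of_lt_pi_div_two (by linarith [mem.1]) (by linarith [mem.2])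
  rw [abs_neg, abs_of_pos tan_pos, shiftedLogSineIntegrand,
    neg_two_mul_log_sin_half_logSineAngle hσ ht, logSineDeriv, lehmerKernel_zero_left, sub_sub,
    one_add_one_eq_two, Complex.real_smul, smul_eq_mul, Complex.ofReal_mul]
  ring

theorem intervalIntegrable_shiftedLogSineIntegrand (hσ : σ ∈ Ioo 0 π) {s : ℂ} (hs : 1 < s.re) :
    IntervalIntegrable (shiftedLogSineIntegrand s σ) volume 0 σ := by
  rw [intervalIntegrable_iff_integrableOn_Ioo_of_le hσ.1.le, ← (bijOn_logSineAngle hσ).image_eq,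
    integrableOn_image_iff_integrableOn_abs_deriv_smul measurableSet_Ioi
      (fun t ht => (hasDerivAt_logSineAngle hσ (le_of_lt ht)).hasDerivWithinAt)
      (bijOn_logSineAngle hσ).injOn]
  have convergent := (isDecayingDerivSeq_logSineDeriv hσ).mellinConvergent 0 (s := s - 1)
    (by simpa using hs)
  exact convergent.congr_fun
    (fun t ht => (abs_deriv_smul_shiftedLogSineIntegrand hσ s (le_of_lt ht)).symm) measurableSet_Ioi

theorem shiftedLogSine_eq_mellin (hσ : σ ∈ Ioo 0 π) (s : ℂ) :
    shiftedLogSine s σ =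
      (Complex.Gamma (s - 1))⁻¹ • mellin (fun t => (logSineDeriv σ 0 t : ℂ)) (s - 1) := by
  rw [shiftedLogSine, one_div, intervalIntegral.integral_of_le hσ.1.le,
    integral_Ioc_eq_integral_Ioo, ← (bijOn_logSineAngle hσ).image_eq,
    integral_image_eq_integral_abs_deriv_smul measurableSet_Ioi
      (fun t ht => (hasDerivAt_logSineAngle hσ (le_of_lt ht)).hasDerivWithinAt)
      (bijOn_logSineAngle hσ).injOn, mellin, smul_eq_mul]
  congr 1
  exact setIntegral_congr_fun measurableSet_Ioi
    fun t ht => abs_deriv_smul_shiftedLogSineIntegrand hσ s (le_of_lt ht)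

theorem isShiftedLogSineContinuation_entireMellin (hσ : σ ∈ Ioo 0 π) :
    IsShiftedLogSineContinuation σ
      fun s => entireMellin (fun m t => (logSineDeriv σ m t : ℂ)) (s - 1) := by
  have H := isDecayingDerivSeq_logSineDeriv hσ
  refine ⟨H.differentiable_entireMellin.comp (differentiable_id.sub_const 1), fun s hs => ?_⟩
  exact (H.entireMellin_eq_mellin (by simpa using hs)).trans (shiftedLogSine_eq_mellin hσ s).symm

namespace IsShiftedLogSineContinuation

variable {F G : ℂ → ℂ}

theorem unique (hF : IsShiftedLogSineContinuation σ F) (hG : IsShiftedLogSineContinuation σ G) :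
    F = G := by
  refine AnalyticOnNhd.eq_of_eventuallyEq (z₀ := 2)
    (Complex.analyticOnNhd_univ_iff_differentiable.2 hF.1)
    (Complex.analyticOnNhd_univ_iff_differentiable.2 hG.1) ?_
  have eventually_one_lt : ∀ᶠ z : ℂ in 𝓝 2, 1 < z.re :=
    Complex.continuous_re.continuousAt.eventually_const_lt (by norm_num)
  filter_upwards [eventually_one_lt] with z hz
  rw [hF.2 z hz, hG.2 z hz]

theorem apply_one_sub_natCast (hσ : σ ∈ Ioo 0 π) (hF : IsShiftedLogSineContinuation σ F) (m : ℕ) :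
    F (1 - m) = logSineDeriv σ m 0 := by
  have F_eq := hF.unique (isShiftedLogSineContinuation_entireMellin hσ)
  rw [congrFun F_eq, sub_sub_cancel_left,
    (isDecayingDerivSeq_logSineDeriv hσ).entireMellin_neg_natCast]

theorem apply_neg_intCast (hσ : σ ∈ Ioo 0 π) (hF : IsShiftedLogSineContinuation σ F) {n : ℤ}
    (hn : -1 ≤ n) {x : ℝ} (hx : x = sin (σ / 2) ^ 2) :
    F (-(n : ℂ)) =
      ((x * Polynomial.aeval x (lehmerP n) / ((2 : ℝ) ^ n * (1 - x) ^ (n + 1)) : ℝ) : ℂ) := by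
  obtain ⟨m, rfl⟩ : ∃ m : ℕ, n = m - 1 := ⟨(n + 1).toNat, by lia⟩
  have neg_eq : -(((m : ℤ) - 1 : ℤ) : ℂ) = 1 - m := by simp
  rw [neg_eq, hF.apply_one_sub_natCast hσ, logSineDeriv_apply_zero hσ, ← hx, lehmerP,
    sub_add_cancel, Int.toNat_natCast, zpow_natCast, zpow_sub_one₀ two_ne_zero, zpow_natCast,
    inv_pow, mul_pow]
  congr 1
  field

end IsShiftedLogSineContinuation

/-- The `n`-th derivative of the differential equation `2 (1 - r e^(-t)) f' + f + 2 r e^(-t) = 0`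
for `f = logSineDeriv σ 0` and `r = sin (σ/2)^2`. -/
theorem logSineDeriv_recurrence (hσ : σ ∈ Ioo 0 π) (n : ℕ) (ht : 0 ≤ t) :
    2 * logSineDeriv σ (n + 1) t - 2 * (sin (σ / 2) ^ 2 * exp (-t)) *
        ∑ i ∈ Finset.range (n + 1), (n.choose i : ℝ) * logSineDeriv σ (i + 1) t =
      logSineDeriv σ n t + 2 * (sin (σ / 2) ^ 2 * exp (-t)) := by
  induction n generalizing t with
  | zero =>
    have base := two_mul_cos_half_sq_mul_lehmerKernel_one σ
      (cos_half_pos (logSineAngle_mem_Ioo_pi hσ ht)).ne'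
    rw [cos_sq', sin_half_logSineAngle_sq hσ ht] at base
    simp only [logSineDeriv, zero_add, Finset.sum_range_one, Nat.choose_self, Nat.cast_one, one_mul]
    linear_combination base
  | succ n ih =>
    have exp_deriv : HasDerivAt (fun t => 2 * (sin (σ / 2) ^ 2 * exp (-t)))
        (-(2 * (sin (σ / 2) ^ 2 * exp (-t)))) t := by
      simpa using ((hasDerivAt_neg t).exp.const_mul (sin (σ / 2) ^ 2)).const_mul 2
    have sum_deriv := HasDerivAt.fun_sum (u := Finset.range (n + 1)) fun i _ =>
      (hasDerivAt_logSineDeriv hσ (i + 1) ht).const_mul (n.choose i : ℝ)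
    have lhs_deriv := ((hasDerivAt_logSineDeriv hσ (n + 1) ht).const_mul 2).sub
      (exp_deriv.mul sum_deriv)
    have rhs_deriv := (hasDerivAt_logSineDeriv hσ n ht).add exp_deriv
    have deriv_eq := (uniqueDiffOn_Ici (0 : ℝ) t ht).eq_deriv _ lhs_deriv.hasDerivWithinAt
      (rhs_deriv.hasDerivWithinAt.congr (fun u hu => ih hu) (ih ht))
    simp only [mul_neg, Finset.sum_neg_distrib] at deriv_eq
    rw [Finset.sum_choose_succ_mul fun i _ => logSineDeriv σ (i + 1) t]
    linear_combination -deriv_eq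

theorem logSineDeriv_pi_div_three_succ (n : ℕ) :
    logSineDeriv (π / 3) (n + 1) 0 =
      ((1 / 3 * ∑ k ∈ Finset.range (n + 1), polyBernoulli (-(k : ℤ)) (n - k) : ℚ) : ℝ) := by
  have hσ : π / 3 ∈ Ioo 0 π := ⟨by positivity, by linarith [pi_pos]⟩
  have sin_half_sq : sin (π / 3 / 2) ^ 2 = 1 / 4 := by
    rw [div_div, show (3 * 2 : ℝ) = 6 by norm_num, sin_pi_div_six]
    norm_num
  have zero : logSineDeriv (π / 3) 0 0 = 0 := by
    rw [logSineDeriv_apply_zero hσ]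
    simp [lehmerPair]
  have three_mul := three_mul_eq_sum_polyBernoulli_of_recurrence
    (a := fun m => logSineDeriv (π / 3) m 0) zero (fun m => by
      have recurrence := logSineDeriv_recurrence hσ m le_rfl
      rw [sin_half_sq, neg_zero, exp_zero] at recurrence
      linear_combination 2 * recurrence) n
  rw [Rat.cast_mul, ← three_mul]
  push_cast
  ring

end LogSineDeriv

theorem theorem1p1 :
    (∀ σ : ℝ, 0 < σ → σ < Real.pi →
      (∀ s : ℂ, 1 < s.re →
        IntervalIntegrable (shiftedLogSineIntegrand s σ) MeasureTheory.volume 0 σ) ∧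
      (∃! F : ℂ → ℂ, IsShiftedLogSineContinuation σ F) ∧
      (∀ F : ℂ → ℂ, IsShiftedLogSineContinuation σ F →
        ∀ n : ℤ, -1 ≤ n → ∀ x : ℝ, x = Real.sin (σ / 2) ^ 2 →
          F (-(n : ℂ)) =
            ((x * Polynomial.aeval x (lehmerP n) / ((2 : ℝ) ^ n * (1 - x) ^ (n + 1)) : ℝ) : ℂ))) ∧
    (∀ F : ℂ → ℂ, IsShiftedLogSineContinuation (Real.pi / 3) F →
      ∀ n : ℕ, F (-(n : ℂ)) =
        ((1 / 3 * ∑ k ∈ Finset.range (n + 1), polyBernoulli (-(k : ℤ)) (n - k) : ℚ) : ℂ)) := by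
  refine ⟨fun σ h0 hπ => ?_, fun F hF n => ?_⟩
  · have hσ : σ ∈ Set.Ioo 0 Real.pi := ⟨h0, hπ⟩
    have continuation := isShiftedLogSineContinuation_entireMellin hσ
    exact ⟨fun s hs => intervalIntegrable_shiftedLogSineIntegrand hσ hs,
      ⟨_, continuation, fun G hG => hG.unique continuation⟩,
      fun F hF n hn x hx => hF.apply_neg_intCast hσ hn hx⟩
  · have hσ : Real.pi / 3 ∈ Set.Ioo 0 Real.pi := ⟨by positivity, by linarith [Real.pi_pos]⟩
    have neg_eq : -(n : ℂ) = 1 - (n + 1 : ℕ) := by simp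
    rw [neg_eq, hF.apply_one_sub_natCast hσ, logSineDeriv_pi_div_three_succ, Complex.ofReal_ratCast]
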